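/- Let $A,B$ be real $2\times 2$ matrices, $[A,B]=AB-BA$, and consider the bilinear control system $$\Sigma:\quad \dot x(t)=(A+u(t)B)\,x(t),\qquad x(t)\in\mathbb{R}^2\smallsetminus\{0\},$$ whose admissible controls are the piecewise constant functions $u:\mathbb{R}\to\mathbb{R}$ (locally constant away from a set of switching times that has finitely many points in each bounded interval). A trajectory for $u$ is a continuous curve $x:\mathbb{R}\to\mathbb{R}^2\smallsetminus\{0\}$ that satisfies the differential equation at every $t$ near which $u$ is constant. The system is called controllable on $\mathbb{R}^2\smallsetminus\{0\}$ if for all $p,q\in\mathbb{R}^2\smallsetminus\{0\}$ there are an admissible control $u$, a trajectory $x$ for $u$ and a time $T>0$ with $x(0)=p$ and $x(T)=q$. Suppose that 1. $\det(A)\det[A,B]>0$ or $\det(B)\det[A,B]>0$; 2. there is $u\in\mathbb{R}$ such that $A+uB$ has a non-real complex eigenvalue (equivalently, $\operatorname{tr}^2(A+uB)-4\det(A+uB)<0$); 3. $\operatorname{tr}(B)=0$. Then $\Sigma$ is controllable on $\mathbb{R}^2\smallsetminus\{0\}$. -/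

import Mathlib

open scoped Matrix Topology

namespace BilinearControl

/-- Admissible controls with values in `U`: functions `u : ℝ → U` that are piecewise constant,
i.e. locally constant away from a set of switching times having finitely many points in
each bounded interval. -/
def IsAdmissible (U : Set ℝ) (u : ℝ → ℝ) : Prop :=
  (∀ t, u t ∈ U) ∧
    ∃ S : Set ℝ, (∀ a b : ℝ, (S ∩ Set.Icc a b).Finite) ∧
      ∀ t, t ∉ S → ∀ᶠ s in 𝓝 t, u s = u t

/-- `x` is a trajectory in `ℝ² \ {0}` of `x' = (A + u B) x` under the control `u`: it is
continuous and solves the equation at every time that is not a switching time of `u`. -/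
def IsTrajectory (A B : Matrix (Fin 2) (Fin 2) ℝ) (u : ℝ → ℝ) (x : ℝ → Fin 2 → ℝ) : Prop :=
  Continuous x ∧ (∀ t, x t ≠ 0) ∧
    ∀ t, (∀ᶠ s in 𝓝 t, u s = u t) → HasDerivAt x ((A + u t • B) *ᵥ x t) t

/-- Controllability on `ℝ² \ {0}` of `x' = (A + u B) x` with control range `U`: any nonzero state
can be steered to any nonzero state in some positive time by an admissible control. -/
def IsControllable (A B : Matrix (Fin 2) (Fin 2) ℝ) (U : Set ℝ) : Prop :=
  ∀ p q : Fin 2 → ℝ, p ≠ 0 → q ≠ 0 →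
    ∃ (u : ℝ → ℝ) (x : ℝ → Fin 2 → ℝ) (T : ℝ),
      IsAdmissible U u ∧ IsTrajectory A B u x ∧ 0 < T ∧ x 0 = p ∧ x T = q

/-- The real matrix `M` has a complex, non-real, eigenvalue. -/
def HasNonrealEigenvalue (M : Matrix (Fin 2) (Fin 2) ℝ) : Prop :=
  ∃ z : ℂ, z.im ≠ 0 ∧
    Module.End.HasEigenvalue (Matrix.toLin' (M.map (fun r : ℝ => (r : ℂ)))) z

end BilinearControl

/-! Some constant control makes the system a spiral. Since `⁅A + a • B, B⁆ = ⁅A, B⁆`, the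
determinant of the commutator is then at most zero (`det_lie_nonpos`), so the sign condition forces
`det A < 0` or `det B < 0`. In either case some `A + b • B` has negative determinant and is a
saddle, with `b = 0` or `b` large. A spiral and a saddle suffice
(`isControllable_of_spiral_of_saddle`): the spiral reaches every direction, and dwelling on the
unstable or stable line of the saddle corrects the norm. Only explicit flow lines are needed, glued
by `IsFlowLine.steers_trans`. -/

namespace BilinearControl

/-! ### Concatenation of trajectories -/

/-- `y` is a nowhere vanishing solution of `y' = M y` on the whole line. -/
def IsFlowLine (M : Matrix (Fin 2) (Fin 2) ℝ) (y : ℝ → Fin 2 → ℝ) : Prop :=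
  (∀ t, HasDerivAt y (M *ᵥ y t) t) ∧ ∀ t, y t ≠ 0

theorem IsFlowLine.smul {M : Matrix (Fin 2) (Fin 2) ℝ} {y : ℝ → Fin 2 → ℝ}
    (hy : IsFlowLine M y) {r : ℝ} (hr : r ≠ 0) : IsFlowLine M (fun t => r • y t) := by
  refine ⟨fun t => ?_, fun t => smul_ne_zero hr (hy.2 t)⟩
  rw [Matrix.mulVec_smul]
  exact (hy.1 t).const_smul r

/-- `q` is reached from `p` in time `T ≥ 0` along a trajectory which also has the expected right
derivative at the switching times. -/
def Steers (A B : Matrix (Fin 2) (Fin 2) ℝ) (T : ℝ) (p q : Fin 2 → ℝ) : Prop :=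
  ∃ (u : ℝ → ℝ) (x : ℝ → Fin 2 → ℝ), IsAdmissible Set.univ u ∧ IsTrajectory A B u x ∧
    (∀ t, HasDerivWithinAt x ((A + u t • B) *ᵥ x t) (Set.Ici t) t) ∧ 0 ≤ T ∧ x 0 = p ∧ x T = q

theorem IsFlowLine.steers {A B : Matrix (Fin 2) (Fin 2) ℝ} {c : ℝ} {y : ℝ → Fin 2 → ℝ}
    (hy : IsFlowLine (A + c • B) y) {T : ℝ} (hT : 0 ≤ T) : Steers A B T (y 0) (y T) := by
  refine ⟨fun _ => c, y, ⟨fun _ => trivial, ∅, by simp, by simp⟩, ⟨?_, hy.2, fun t _ => hy.1 t⟩,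
    fun t => (hy.1 t).hasDerivWithinAt, hT, rfl, rfl⟩
  exact continuous_iff_continuousAt.2 fun t => (hy.1 t).continuousAt

/-- A flow line for a constant control may be put in front of a trajectory. -/
theorem IsFlowLine.steers_trans {A B : Matrix (Fin 2) (Fin 2) ℝ} {c : ℝ} {y : ℝ → Fin 2 → ℝ}
    (hy : IsFlowLine (A + c • B) y) {τ : ℝ} (hτ : 0 ≤ τ) {T : ℝ} {q : Fin 2 → ℝ}
    (h : Steers A B T (y τ) q) : Steers A B (τ + T) (y 0) q := by
  obtain ⟨u, x, ⟨-, S, hS, hu⟩, ⟨hxc, hx0, hxd⟩, hxr, hT, h0, hq⟩ := h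
  have hyc : Continuous y := continuous_iff_continuousAt.2 fun t => (hy.1 t).continuousAt
  set w : ℝ → ℝ := fun t => if t < τ then c else u (t - τ) with hw
  set z : ℝ → Fin 2 → ℝ := fun t => if t < τ then y t else x (t - τ) with hz
  have w_lt : ∀ t, t < τ → w t = c := fun t ht => by simp [hw, ht]
  have w_ge : ∀ t, τ ≤ t → w t = u (t - τ) := fun t ht => by simp [hw, not_lt.2 ht]
  have z_lt : ∀ t, t < τ → z t = y t := fun t ht => by simp [hz, ht]
  have z_ge : ∀ t, τ ≤ t → z t = x (t - τ) := fun t ht => by simp [hz, not_lt.2 ht]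
  have shift : ∀ t, Filter.Tendsto (fun s : ℝ => s + τ) (𝓝 (t - τ)) (𝓝 t) := fun t => by
    have : ContinuousAt (fun s : ℝ => s + τ) (t - τ) := by fun_prop
    simpa [ContinuousAt] using this
  have unshift : ∀ t, Filter.Tendsto (fun s : ℝ => s - τ) (𝓝 t) (𝓝 (t - τ)) := fun t =>
    (continuous_id.sub continuous_const).tendsto t
  have hleft : ∀ t, t < τ → HasDerivAt z ((A + w t • B) *ᵥ z t) t := fun t ht => by
    rw [w_lt t ht, z_lt t ht]
    refine (hy.1 t).congr_of_eventuallyEq ?_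
    filter_upwards [Iio_mem_nhds ht] with s hs using z_lt s hs
  have hright : ∀ t, HasDerivWithinAt z ((A + w t • B) *ᵥ z t) (Set.Ici t) t := fun t => by
    rcases lt_or_ge t τ with ht | ht
    · exact (hleft t ht).hasDerivWithinAt
    · rw [w_ge t ht, z_ge t ht]
      have h1 : HasDerivWithinAt (fun s => x (s - τ)) ((A + u (t - τ) • B) *ᵥ x (t - τ))
          (Set.Ici t) t := by
        have := (hxr (t - τ)).scomp t (((hasDerivAt_id t).sub_const τ).hasDerivWithinAt)
          (s := Set.Ici t) (fun s hs => by simpa using hs)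
        simpa [Function.comp_def] using this
      exact h1.congr (fun s hs => z_ge s (ht.trans hs)) (z_ge t ht)
  refine ⟨w, z, ⟨fun _ => trivial, insert τ (Set.image (fun s => s + τ) S), fun a b => ?_, ?_⟩,
    ⟨?_, ?_, ?_⟩, hright, by positivity, ?_, ?_⟩
  · refine ((((hS (a - τ) (b - τ)).image fun s => s + τ)).insert τ).subset ?_
    rintro t ⟨rfl | ⟨s, hs, rfl⟩, ht⟩
    · exact Set.mem_insert _ _
    · refine Set.mem_insert_of_mem _ ⟨s, ⟨hs, ?_⟩, rfl⟩
      simp only [Set.mem_Icc] at ht ⊢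
      constructor <;> linarith [ht.1, ht.2]
  · intro t ht
    rw [Set.mem_insert_iff, not_or] at ht
    rcases lt_or_gt_of_ne ht.1 with h | h
    · filter_upwards [Iio_mem_nhds h] with s hs
      rw [w_lt t h, w_lt s hs]
    · have hS' : t - τ ∉ S := fun hs => ht.2 ⟨t - τ, hs, by simp⟩
      filter_upwards [Ioi_mem_nhds h, (unshift t).eventually (hu _ hS')] with s hs hs'
      rw [w_ge t h.le, w_ge s (le_of_lt hs), hs']
  · refine Continuous.if (fun t ht => ?_) hyc (hxc.comp (continuous_id.sub continuous_const))
    rw [show {t : ℝ | t < τ} = Set.Iio τ from rfl, frontier_Iio] at ht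
    rw [Set.mem_singleton_iff.1 ht]
    simp [h0]
  · intro t
    rcases lt_or_ge t τ with ht | ht
    · rw [z_lt t ht]; exact hy.2 t
    · rw [z_ge t ht]; exact hx0 _
  · intro t ht
    rcases lt_trichotomy t τ with h | rfl | h
    · exact hleft t h
    -- The switch at the junction may be spurious: if `u` jumps at 0 to the value `c`, then `w` is
    -- constant near `τ` and the equation must hold there. The left derivative comes from `y`, the
    -- right one from the extra clause in `Steers`.
    · have hc : w t = c := by
        obtain ⟨s, hs, hst⟩ := ((ht.filter_mono nhdsWithin_le_nhds).and
          (self_mem_nhdsWithin : Set.Iio t ∈ 𝓝[<] t)).exists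
        rw [← hs, w_lt s hst]
      have hzt : z t = y t := by rw [z_ge t le_rfl, sub_self, h0]
      have hl : HasDerivWithinAt z ((A + w t • B) *ᵥ z t) (Set.Iic t) t := by
        rw [hc, hzt]
        refine (hy.1 t).hasDerivWithinAt.congr (fun s hs => ?_) hzt
        rcases eq_or_lt_of_le (Set.mem_Iic.1 hs) with rfl | h
        · exact hzt
        · exact z_lt s h
      have := hl.union (hright t)
      rwa [Set.Iic_union_Ici, hasDerivWithinAt_univ] at this
    · have hu' : ∀ᶠ s in 𝓝 (t - τ), u s = u (t - τ) := by
        filter_upwards [(shift t).eventually ht,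
          (shift t).eventually (Ioi_mem_nhds h)] with s hs hs'
        rw [w_ge t h.le, w_ge _ (le_of_lt hs')] at hs
        simpa using hs
      rw [w_ge t h.le, z_ge t h.le]
      refine ((hxd _ hu').comp_sub_const t τ).congr_of_eventuallyEq ?_
      filter_upwards [Ioi_mem_nhds h] with s hs using z_ge s (le_of_lt hs)
  · rcases hτ.lt_or_eq with h | rfl
    · exact z_lt 0 h
    · rw [z_ge 0 le_rfl, sub_self, h0]
  · rw [z_ge _ (by linarith), add_sub_cancel_left, hq]

/-! ### Spirals -/

/-- A real matrix with a non-real eigenvalue has negative discriminant. -/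
theorem HasNonrealEigenvalue.discr_neg {M : Matrix (Fin 2) (Fin 2) ℝ}
    (h : HasNonrealEigenvalue M) : (M 0 0 - M 1 1) ^ 2 + 4 * (M 0 1 * M 1 0) < 0 := by
  obtain ⟨z, hz, hev⟩ := h
  obtain ⟨v, hv, hv0⟩ := hev.exists_hasEigenvector
  rw [Module.End.mem_eigenspace_iff, Matrix.toLin'_apply] at hv
  have e0 := congrFun hv 0
  have e1 := congrFun hv 1
  simp only [Matrix.mulVec, dotProduct, Fin.sum_univ_two, Matrix.map_apply, Pi.smul_apply,
    smul_eq_mul] at e0 e1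
  have hchar : ((M 0 0 : ℂ) - z) * (M 1 1 - z) - M 0 1 * M 1 0 = 0 := by
    by_contra hne
    refine hv0 (funext fun i => ?_)
    fin_cases i
    · refine (mul_eq_zero.1 (?_ : (((M 0 0 : ℂ) - z) * (M 1 1 - z) - M 0 1 * M 1 0) * v 0 = 0)
        ).resolve_left hne
      linear_combination (M 1 1 - z) * e0 - M 0 1 * e1
    · refine (mul_eq_zero.1 (?_ : (((M 0 0 : ℂ) - z) * (M 1 1 - z) - M 0 1 * M 1 0) * v 1 = 0)
        ).resolve_left hne
      linear_combination (M 0 0 - z) * e1 - M 1 0 * e0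
  have hre := congrArg Complex.re hchar
  have him := congrArg Complex.im hchar
  simp at hre him
  have htr : z.re = (M 0 0 + M 1 1) / 2 := by
    refine mul_left_cancel₀ hz ?_
    linear_combination him / 2
  have hpos : 0 < z.im ^ 2 := by positivity
  rw [htr] at hre
  nlinarith

/-- The flow lines of a matrix with negative discriminant spiral around the origin, so that each
of them meets every ray. -/
theorem exists_isFlowLine_meets_ray {M : Matrix (Fin 2) (Fin 2) ℝ}
    (hM : (M 0 0 - M 1 1) ^ 2 + 4 * (M 0 1 * M 1 0) < 0) {p v : Fin 2 → ℝ}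
    (hp : p ≠ 0) (hv : v ≠ 0) :
    ∃ (y : ℝ → Fin 2 → ℝ) (t k : ℝ), IsFlowLine M y ∧ y 0 = p ∧ 0 < t ∧ 0 < k ∧ y t = k • v := by
  set δ := (M 0 0 - M 1 1) / 2 with hδ
  set μ := (M 0 0 + M 1 1) / 2 with hμ
  set ω := √(-(δ ^ 2 + M 0 1 * M 1 0)) with hω
  have hneg : 0 < -(δ ^ 2 + M 0 1 * M 1 0) := by rw [hδ]; linarith
  have hω0 : 0 < ω := Real.sqrt_pos.2 hneg
  have hω2 : ω ^ 2 = -(δ ^ 2 + M 0 1 * M 1 0) := Real.sq_sqrt hneg.le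
  -- `n = (M - μ) p / ω`. As `(M - μ)² = -ω²`, in the basis `p, n` the matrix `M` acts as the
  -- complex number `μ + iω`.
  set n : Fin 2 → ℝ := ![(δ * p 0 + M 0 1 * p 1) / ω, (M 1 0 * p 0 - δ * p 1) / ω] with hn
  have n0 : ω * n 0 = δ * p 0 + M 0 1 * p 1 := by simp [hn]; field_simp
  have n1 : ω * n 1 = M 1 0 * p 0 - δ * p 1 := by simp [hn]; field_simp
  have m00 : M 0 0 = μ + δ := by rw [hμ, hδ]; ring
  have m11 : M 1 1 = μ - δ := by rw [hμ, hδ]; ring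
  have hMp : M *ᵥ p = μ • p + ω • n := by
    ext i; fin_cases i
    · simp [Matrix.mulVec, dotProduct, Fin.sum_univ_two]; linear_combination p 0 * m00 - n0
    · simp [Matrix.mulVec, dotProduct, Fin.sum_univ_two]; linear_combination p 1 * m11 - n1
  have hMn : M *ᵥ n = μ • n - ω • p := by
    ext i; fin_cases i
    · refine mul_left_cancel₀ hω0.ne' ?_
      simp only [Matrix.mulVec, dotProduct, Fin.sum_univ_two, Pi.sub_apply, Pi.smul_apply,
        smul_eq_mul, Fin.zero_eta]
      linear_combination ω * n 0 * m00 + δ * n0 + M 0 1 * n1 + p 0 * hω2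
    · refine mul_left_cancel₀ hω0.ne' ?_
      simp only [Matrix.mulVec, dotProduct, Fin.sum_univ_two, Pi.sub_apply, Pi.smul_apply,
        smul_eq_mul, Fin.mk_one]
      linear_combination ω * n 1 * m11 - δ * n1 + M 1 0 * n0 + p 1 * hω2
  have hb : M 0 1 ≠ 0 := by
    intro h
    rw [h] at hM
    nlinarith [sq_nonneg (M 0 0 - M 1 1)]
  have hD : p 0 * n 1 - p 1 * n 0 ≠ 0 := by
    intro h
    -- Up to the factor `-M 0 1 * ω`, the determinant of `(p, n)` is a definite quadratic form in
    -- `p`.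
    have h1 : (M 0 1 * p 1 + δ * p 0) ^ 2 + ω ^ 2 * p 0 ^ 2 = 0 := by
      linear_combination p 0 ^ 2 * hω2 - M 0 1 * ω * h + M 0 1 * p 0 * n1 - M 0 1 * p 1 * n0
    have h2 : ω ^ 2 * p 0 ^ 2 = 0 := by
      nlinarith [sq_nonneg (M 0 1 * p 1 + δ * p 0), sq_nonneg (ω * p 0)]
    have h3 : p 0 = 0 := by simpa [hω0.ne'] using h2
    have h4 : p 1 = 0 := by simpa [h3, hb] using h1
    exact hp (funext fun i => by fin_cases i <;> assumption)
  have indep : ∀ a b : ℝ, a • p + b • n = 0 → a = 0 ∧ b = 0 := by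
    intro a b h
    have g0 := congrFun h 0
    have g1 := congrFun h 1
    simp at g0 g1
    constructor
    · refine (mul_eq_zero.1 (?_ : a * (p 0 * n 1 - p 1 * n 0) = 0)).resolve_right hD
      linear_combination n 1 * g0 - n 0 * g1
    · refine (mul_eq_zero.1 (?_ : b * (p 0 * n 1 - p 1 * n 0) = 0)).resolve_right hD
      linear_combination p 0 * g1 - p 1 * g0
  obtain ⟨a, b, hab⟩ : ∃ a b : ℝ, v = a • p + b • n := by
    refine ⟨(v 0 * n 1 - v 1 * n 0) / (p 0 * n 1 - p 1 * n 0),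
      (p 0 * v 1 - p 1 * v 0) / (p 0 * n 1 - p 1 * n 0), ?_⟩
    ext i; fin_cases i
    · simp only [Pi.add_apply, Pi.smul_apply, smul_eq_mul]
      rw [div_mul_eq_mul_div, div_mul_eq_mul_div, ← add_div, eq_div_iff hD]
      simp only [Fin.zero_eta]
      ring
    · simp only [Pi.add_apply, Pi.smul_apply, smul_eq_mul]
      rw [div_mul_eq_mul_div, div_mul_eq_mul_div, ← add_div, eq_div_iff hD]
      simp only [Fin.mk_one]
      ring
  set ζ : ℂ := ⟨a, b⟩ with hζ
  have hζ0 : ζ ≠ 0 := by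
    intro h
    have ha : a = 0 := congrArg Complex.re h
    have hb : b = 0 := congrArg Complex.im h
    exact hv (by rw [hab, ha, hb]; simp)
  have hr : 0 < ‖ζ‖ := norm_pos_iff.2 hζ0
  have hcos : ‖ζ‖ * Real.cos ζ.arg = a := Complex.norm_mul_cos_arg ζ
  have hsin : ‖ζ‖ * Real.sin ζ.arg = b := Complex.norm_mul_sin_arg ζ
  -- The flow reaches the ray of `v` when the angle `ω t` equals the argument of `ζ`; the added full
  -- turn makes this time positive.
  refine ⟨fun t => Real.exp (μ * t) • (Real.cos (ω * t) • p + Real.sin (ω * t) • n),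
    (ζ.arg + 2 * Real.pi) / ω, Real.exp (μ * ((ζ.arg + 2 * Real.pi) / ω)) / ‖ζ‖,
    ⟨fun t => ?_, fun t h => ?_⟩, by simp, ?_, by positivity, ?_⟩
  · have he : HasDerivAt (fun t => Real.exp (μ * t)) (Real.exp (μ * t) * μ) t := by
      simpa using ((hasDerivAt_id t).const_mul μ).exp
    have hc : HasDerivAt (fun t => Real.cos (ω * t)) (-Real.sin (ω * t) * ω) t := by
      simpa using ((hasDerivAt_id t).const_mul ω).cos
    have hs : HasDerivAt (fun t => Real.sin (ω * t)) (Real.cos (ω * t) * ω) t := by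
      simpa using ((hasDerivAt_id t).const_mul ω).sin
    refine (he.fun_smul ((hc.smul_const p).fun_add (hs.smul_const n))).congr_deriv ?_
    rw [Matrix.mulVec_smul, Matrix.mulVec_add, Matrix.mulVec_smul, Matrix.mulVec_smul, hMp, hMn]
    module
  · obtain ⟨hc, hs⟩ := indep _ _ ((smul_eq_zero.1 h).resolve_left (Real.exp_pos _).ne')
    have := Real.sin_sq_add_cos_sq (ω * t)
    rw [hc, hs] at this
    norm_num at this
  · have := Complex.neg_pi_lt_arg ζ
    have := Real.pi_pos
    exact div_pos (by linarith) hω0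
  · have hωt : ω * ((ζ.arg + 2 * Real.pi) / ω) = ζ.arg + 2 * Real.pi := by field_simp
    simp only [hωt, Real.cos_add_two_pi, Real.sin_add_two_pi]
    rw [hab, div_eq_mul_inv (Real.exp _), mul_smul]
    congr 1
    rw [← hcos, ← hsin, smul_add, smul_smul, smul_smul, inv_mul_cancel_left₀ hr.ne',
      inv_mul_cancel_left₀ hr.ne']

/-! ### Saddles and determinant signs -/

theorem isFlowLine_of_mulVec_eq_smul {M : Matrix (Fin 2) (Fin 2) ℝ} {l : ℝ} {v : Fin 2 → ℝ}
    (hv : v ≠ 0) (h : M *ᵥ v = l • v) : IsFlowLine M (fun t => Real.exp (l * t) • v) := by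
  refine ⟨fun t => ?_, fun t => smul_ne_zero (Real.exp_pos _).ne' hv⟩
  have he : HasDerivAt (fun t => Real.exp (l * t)) (Real.exp (l * t) * l) t := by
    simpa using ((hasDerivAt_id t).const_mul l).exp
  refine (he.smul_const v).congr_deriv ?_
  rw [Matrix.mulVec_smul, h, smul_smul]

/-- A matrix with negative determinant has eigenvectors for eigenvalues of both signs. -/
theorem exists_eigenvectors_of_det_neg {M : Matrix (Fin 2) (Fin 2) ℝ} (hM : M.det < 0) :
    (∃ (l : ℝ) (v : Fin 2 → ℝ), 0 < l ∧ v ≠ 0 ∧ M *ᵥ v = l • v) ∧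
      ∃ (l : ℝ) (v : Fin 2 → ℝ), l < 0 ∧ v ≠ 0 ∧ M *ᵥ v = l • v := by
  have key : ∀ l : ℝ, l ^ 2 - M.trace * l + M.det = 0 →
      ∃ v : Fin 2 → ℝ, v ≠ 0 ∧ M *ᵥ v = l • v := by
    intro l hl
    have hdet : (M - l • (1 : Matrix (Fin 2) (Fin 2) ℝ)).det = 0 := by
      rw [Matrix.det_fin_two, Matrix.trace_fin_two] at hl
      simp [Matrix.det_fin_two]
      linear_combination hl
    obtain ⟨v, hv, h⟩ := Matrix.exists_mulVec_eq_zero_iff.2 hdet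
    refine ⟨v, hv, ?_⟩
    rwa [Matrix.sub_mulVec, Matrix.smul_mulVec, Matrix.one_mulVec, sub_eq_zero] at h
  have hs : √(M.trace ^ 2 - 4 * M.det) ^ 2 = M.trace ^ 2 - 4 * M.det :=
    Real.sq_sqrt (by nlinarith [sq_nonneg M.trace])
  have hlt : |M.trace| < √(M.trace ^ 2 - 4 * M.det) :=
    Real.lt_sqrt_of_sq_lt (by rw [sq_abs]; linarith)
  obtain ⟨h1, h2⟩ := abs_lt.1 hlt
  constructor
  · obtain ⟨v, hv, h⟩ := key ((M.trace + √(M.trace ^ 2 - 4 * M.det)) / 2)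
      (by linear_combination hs / 4)
    exact ⟨_, v, by linarith, hv, h⟩
  · obtain ⟨v, hv, h⟩ := key ((M.trace - √(M.trace ^ 2 - 4 * M.det)) / 2)
      (by linear_combination hs / 4)
    exact ⟨_, v, by linarith, hv, h⟩

/-- On trace-free matrices `tr X² = -2 det X` has signature (2,1). The trace-free part of `M` is a
negative vector and `⁅M, B⁆` is orthogonal to it, hence lies in a positive definite plane. The proof
is the corresponding completion of squares. -/
theorem det_lie_nonpos {M : Matrix (Fin 2) (Fin 2) ℝ}
    (hM : (M 0 0 - M 1 1) ^ 2 + 4 * (M 0 1 * M 1 0) < 0) (B : Matrix (Fin 2) (Fin 2) ℝ) :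
    (⁅M, B⁆).det ≤ 0 := by
  have hn : M 0 1 ≠ 0 := by
    intro h
    rw [h] at hM
    nlinarith [sq_nonneg (M 0 0 - M 1 1)]
  have hn2 : 0 < M 0 1 ^ 2 := by positivity
  set z := M 0 1 * (B 0 0 - B 1 1) - (M 0 0 - M 1 1) * B 0 1 with hz
  set w := M 0 1 * B 1 0 - M 1 0 * B 0 1 with hw
  have key : M 0 1 ^ 2 * (⁅M, B⁆).det = -(M 0 1 * w + z * (M 0 0 - M 1 1) / 2) ^ 2
      + z ^ 2 * ((M 0 0 - M 1 1) ^ 2 + 4 * (M 0 1 * M 1 0)) / 4 := by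
    rw [hz, hw, Ring.lie_def, Matrix.det_fin_two]
    simp only [Matrix.sub_apply, Matrix.mul_apply, Fin.sum_univ_two]
    ring
  have h1 := mul_nonpos_of_nonneg_of_nonpos (sq_nonneg z) hM.le
  have h2 : M 0 1 ^ 2 * (⁅M, B⁆).det ≤ 0 := by
    rw [key]; nlinarith [sq_nonneg (M 0 1 * w + z * (M 0 0 - M 1 1) / 2)]
  by_contra! h
  nlinarith [mul_pos hn2 h]

/-- `det (A + u • B)` is quadratic in `u` with leading coefficient `det B`, so a large `u` works. -/
theorem exists_det_add_smul_neg (A : Matrix (Fin 2) (Fin 2) ℝ) {B : Matrix (Fin 2) (Fin 2) ℝ}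
    (hB : B.det < 0) : ∃ u : ℝ, (A + u • B).det < 0 := by
  set β := A 0 0 * B 1 1 + B 0 0 * A 1 1 - A 0 1 * B 1 0 - B 0 1 * A 1 0 with hβ
  have hdet : ∀ u : ℝ, (A + u • B).det = A.det + u * β + u ^ 2 * B.det := by
    intro u
    simp [Matrix.det_fin_two, hβ]
    ring
  have hu : ∃ u : ℝ, 1 ≤ u ∧ |A.det| + |β| < u * -B.det := by
    refine ⟨1 + (|A.det| + |β|) / -B.det, ?_, ?_⟩
    · have : 0 ≤ (|A.det| + |β|) / -B.det := div_nonneg (by positivity) (by linarith)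
      linarith
    · rw [add_mul, div_mul_cancel₀ _ (by linarith)]
      linarith
  obtain ⟨u, hu1, hu⟩ := hu
  refine ⟨u, ?_⟩
  rw [hdet]
  nlinarith [le_abs_self A.det, le_abs_self β, abs_nonneg A.det,
    mul_lt_mul_of_pos_left hu (by linarith : 0 < u),
    mul_le_mul_of_nonneg_left (le_abs_self β) (by linarith : 0 ≤ u),
    mul_le_mul_of_nonneg_right hu1 (abs_nonneg A.det)]

/-! ### Controllability -/

/-- A system having both a spiral and a saddle among its constant controls is controllable:
spiral to the unstable line of the saddle, expand, spiral to the stable line, contract, and spiral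
to the target. -/
theorem isControllable_of_spiral_of_saddle {A B : Matrix (Fin 2) (Fin 2) ℝ} {a b : ℝ}
    (ha : HasNonrealEigenvalue (A + a • B)) (hb : (A + b • B).det < 0) :
    IsControllable A B Set.univ := by
  intro p q hp hq
  have hM := ha.discr_neg
  obtain ⟨⟨l, v, hl, hv, hlv⟩, m, w, hm, hw, hmw⟩ := exists_eigenvectors_of_det_neg hb
  obtain ⟨x, r, i, hx, hx0, hr, hi, hxr⟩ := exists_isFlowLine_meets_ray hM hp hv
  obtain ⟨y, s, j, hy, hy0, hs, hj, hys⟩ := exists_isFlowLine_meets_ray hM hv hw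
  obtain ⟨z, t, k, hz, hz0, ht, hk, hzt⟩ := exists_isFlowLine_meets_ray hM hw hq
  have hv' := isFlowLine_of_mulVec_eq_smul hv hlv
  have hw' := isFlowLine_of_mulVec_eq_smul hw hmw
  -- The dwell times must contribute `l * σ + m * τ = -L` to cancel the scalings of the three spiral
  -- arcs. Expanding by `|L|` and contracting by `L + |L|` keeps both times nonnegative.
  set L := Real.log (i * j * k) with hL
  set σ := |L| / l with hσ
  set τ := (L + |L|) / -m with hτ
  have hσ0 : 0 ≤ σ := by positivity
  have hτ0 : 0 ≤ τ := div_nonneg (by linarith [neg_abs_le L]) (by linarith)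
  have hscale : Real.exp (m * τ) * (j * (Real.exp (l * σ) * i)) = k⁻¹ := by
    have h1 : l * σ = |L| := by rw [hσ]; field_simp
    have h2 : m * τ = -(L + |L|) := by
      rw [hτ]; have := hm.ne; field_simp
    have h3 : Real.exp L = i * j * k := Real.exp_log (by positivity)
    have h4 : Real.exp (-(L + |L|)) * Real.exp |L| = (i * j * k)⁻¹ := by
      rw [← Real.exp_add, ← h3, ← Real.exp_neg]
      congr 1
      ring
    rw [h1, h2]
    calc _ = Real.exp (-(L + |L|)) * Real.exp |L| * (i * j) := by ring
      _ = k⁻¹ := by rw [h4]; field_simp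
  -- Built backwards from `q`, since gluing prepends arcs; linearity rescales each arc to its actual
  -- starting point.
  have e5 : Steers A B t (k⁻¹ • w) q := by
    have := (hz.smul (inv_ne_zero hk.ne')).steers ht.le
    rwa [hz0, hzt, inv_smul_smul₀ hk.ne'] at this
  set d := Real.exp (l * σ) * i with hd
  have hd0 : 0 < d := by positivity
  have e4 : Steers A B (τ + t) ((j * d) • w) q := by
    have hdj : j * d ≠ 0 := by positivity
    have := (hw'.smul hdj).steers_trans hτ0 (T := t) (q := q)
      (by rwa [smul_smul, mul_comm, hscale])
    simpa using this
  have e3 : Steers A B (s + (τ + t)) (d • v) q := by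
    have := (hy.smul hd0.ne').steers_trans hs.le (T := τ + t) (q := q)
      (by rwa [hys, smul_smul, mul_comm])
    rwa [hy0] at this
  have e2 : Steers A B (σ + (s + (τ + t))) (i • v) q := by
    have := (hv'.smul hi.ne').steers_trans hσ0 (T := s + (τ + t)) (q := q)
      (by rwa [smul_smul, mul_comm])
    simpa using this
  have e1 := hx.steers_trans hr.le (T := σ + (s + (τ + t))) (q := q) (by rwa [hxr])
  rw [hx0] at e1
  obtain ⟨u, ξ, hu, hξ, -, -, h0, hT⟩ := e1
  exact ⟨u, ξ, _, hu, hξ, by positivity, h0, hT⟩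

end BilinearControl

theorem mainTheorem6 (A B : Matrix (Fin 2) (Fin 2) ℝ)
    (h₁ : 0 < A.det * (⁅A, B⁆).det ∨ 0 < B.det * (⁅A, B⁆).det)
    (h₂ : ∃ u : ℝ, BilinearControl.HasNonrealEigenvalue (A + u • B))
    (h₃ : B.trace = 0) :
    BilinearControl.IsControllable A B Set.univ := by
  obtain ⟨a, ha⟩ := h₂
  have hlie : (⁅A, B⁆).det ≤ 0 := by
    have h := BilinearControl.det_lie_nonpos ha.discr_neg B
    have heq : ⁅A + a • B, B⁆ = ⁅A, B⁆ := by
      simp only [Ring.lie_def, add_mul, mul_add, smul_mul_assoc, mul_smul_comm]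
      abel
    rwa [heq] at h
  obtain ⟨b, hb⟩ : ∃ b : ℝ, (A + b • B).det < 0 := by
    rcases h₁ with h | h
    · exact ⟨0, by simpa using neg_of_mul_pos_left h hlie⟩
    · exact BilinearControl.exists_det_add_smul_neg A (neg_of_mul_pos_left h hlie)
  exact BilinearControl.isControllable_of_spiral_of_saddle ha hb
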